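/- Let $M,K\in\mathbb R^{n\times n}$ be symmetric positive definite matrices (the mass and stiffness matrix) and $L=M^{-1}K$. Let $(x,y)_G=x^TGy$, with $G\in\mathbb R^{n\times n}$ symmetric positive definite, be an inner product on $\mathbb R^n$ with respect to which $L$ is self-adjoint, and let $\|x\|=(x,x)_G^{1/2}$. (The choice $G=M$ is always admissible; if $L$ is symmetric, so is $G=I$, for which $\|\cdot\|$ is the Euclidean norm.) Let $\Lambda=[\lambda_{\min}(L),\lambda_{\max}(L)]$ be the spectral interval of $L$ and let $b\in\mathbb R^n$. For $t\in[0,\infty)$ put $w(t)=(tI+L)^{-1}b$, and put $w(\infty)=b$. Let $t_0,\dots,t_k\in[0,\infty]$ be pairwise distinct, let $\mathcal V_{k+1}=\operatorname{span}\{w(t_0),\dots,w(t_k)\}$, and let $V$ be a matrix whose columns form a basis of $\mathcal V_{k+1}$ that is orthonormal with respect to $(\cdot,\cdot)_G$. Let $V^\star=V^TG$ be the adjoint of $V$ (so $V^\star=V^T$ if $G=I$), and let $$w_{k+1}(t)=V\,(tI+V^\star LV)^{-1}V^\star b$$ be the reduced basis approximation of $w(t)$. Then for every $t\ge 0$ and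 every interval $\Sigma=[\lambda_l,\lambda_u]\supseteq\Lambda$ with $\lambda_l>0$, $$\|w_{k+1}(t)-w(t)\|\le\frac{2C}{t+\lambda_l}\,\|\Theta\|_{L_\infty(\Sigma)}\,\|b\|\quad\text{with } C=1,\qquad \Theta(z)=\prod_{\substack{j=0\\ t_j\ne\infty}}^k\frac{z-t_j}{z+t_j},$$ where $\|\Theta\|_{L_\infty(\Sigma)}=\sup_{z\in\Sigma}|\Theta(z)|$. -/

import Mathlib

open scoped Matrix ENNReal

noncomputable section

namespace ReducedBasis

/-- The bilinear form `(x, y)_G = xᵀ G y` (an inner product on `ℝⁿ` if `G` is positive definite). -/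
def ip {n : ℕ} (G : Matrix (Fin n) (Fin n) ℝ) (x y : Fin n → ℝ) : ℝ :=
  x ⬝ᵥ (G *ᵥ y)

/-- The norm `‖x‖_G = (x, x)_G ^ (1/2)`. For `G = 1` this is the Euclidean norm. -/
def ipNorm {n : ℕ} (G : Matrix (Fin n) (Fin n) ℝ) (x : Fin n → ℝ) : ℝ :=
  Real.sqrt (ip G x x)

/-- `L` is self-adjoint with respect to the inner product `(·, ·)_G`. -/
def SelfAdjointWrt {n : ℕ} (G L : Matrix (Fin n) (Fin n) ℝ) : Prop :=
  ∀ x y : Fin n → ℝ, ip G (L *ᵥ x) y = ip G x (L *ᵥ y)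

/-- The discrete diffusion operator `L = M⁻¹ K` (`M` the mass matrix, `K` the stiffness matrix). -/
def diffusionMatrix {n : ℕ} (M K : Matrix (Fin n) (Fin n) ℝ) : Matrix (Fin n) (Fin n) ℝ :=
  M⁻¹ * K

/-- `L = M⁻¹ K` is always self-adjoint in the inner product given by the mass matrix `M`. -/
theorem selfAdjointWrt_mass {n : ℕ} {M K : Matrix (Fin n) (Fin n) ℝ}
    (hM : M.PosDef) (hK : K.PosDef) : SelfAdjointWrt M (diffusionMatrix M K) := by
  intro x y
  have hu : IsUnit M.det := (Matrix.isUnit_iff_isUnit_det M).1 hM.isUnit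
  have hMt : Mᵀ = M := by
    rw [← Matrix.conjTranspose_eq_transpose_of_trivial]
    exact hM.isHermitian.eq
  have hKt : Kᵀ = K := by
    rw [← Matrix.conjTranspose_eq_transpose_of_trivial]
    exact hK.isHermitian.eq
  have h1 : M * (M⁻¹ * K) = K := Matrix.mul_nonsing_inv_cancel_left M K hu
  have h2 : (M⁻¹ * K)ᵀ * M = K := by
    have := congrArg Matrix.transpose h1
    rwa [Matrix.transpose_mul, hMt, hKt] at this
  unfold ip diffusionMatrix
  rw [Matrix.mulVec_mulVec, h1, ← Matrix.vecMul_transpose, ← Matrix.dotProduct_mulVec,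
    Matrix.mulVec_mulVec, h2]

/-- The symmetric matrices are the ones that are self-adjoint in the Euclidean inner product. -/
theorem selfAdjointWrt_one {n : ℕ} {L : Matrix (Fin n) (Fin n) ℝ} (hL : L.IsSymm) :
    SelfAdjointWrt 1 L := by
  intro x y
  unfold ip
  rw [Matrix.one_mulVec, Matrix.one_mulVec, ← Matrix.vecMul_transpose, hL.eq,
    ← Matrix.dotProduct_mulVec]

/-- The spectral interval `Λ = [λ_min(L), λ_max(L)]`. -/
def spectralInterval {n : ℕ} (L : Matrix (Fin n) (Fin n) ℝ) : Set ℝ :=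
  Set.Icc (sInf (spectrum ℝ L)) (sSup (spectrum ℝ L))

/-- The solution `w(t) = (t I + L)⁻¹ b` of the parametric reaction-diffusion equation
for a finite parameter `t`. -/
def resolventSolution {n : ℕ} (L : Matrix (Fin n) (Fin n) ℝ) (b : Fin n → ℝ) (t : ℝ) :
    Fin n → ℝ :=
  (t • (1 : Matrix (Fin n) (Fin n) ℝ) + L)⁻¹ *ᵥ b

/-- `w(τ)` for an extended parameter `τ ∈ [0, ∞]`, with the convention `w(∞) = b`. -/
def snapshotSolution {n : ℕ} (L : Matrix (Fin n) (Fin n) ℝ) (b : Fin n → ℝ) (τ : ℝ≥0∞) :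
    Fin n → ℝ :=
  if τ = ∞ then b else resolventSolution L b τ.toReal

/-- The reduced space `span {w(t₀), …, w(t_k)}`. -/
def reducedSpace {n k : ℕ} (L : Matrix (Fin n) (Fin n) ℝ) (b : Fin n → ℝ)
    (τ : Fin (k + 1) → ℝ≥0∞) : Submodule ℝ (Fin n → ℝ) :=
  Submodule.span ℝ (Set.range fun j => snapshotSolution L b (τ j))

/-- The columns of `V` form a basis of the subspace `S` that is orthonormal for `(·, ·)_G`. -/
def IsOrthonormalBasisOf {n m : ℕ} (G : Matrix (Fin n) (Fin n) ℝ)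
    (V : Matrix (Fin n) (Fin m) ℝ) (S : Submodule ℝ (Fin n → ℝ)) : Prop :=
  Vᵀ * G * V = 1 ∧ Submodule.span ℝ (Set.range fun i => Vᵀ i) = S

/-- The reduced basis (Galerkin) approximation `V (t I + V⋆ L V)⁻¹ V⋆ b`, where `V⋆ = Vᵀ G` is the
adjoint of `V` with respect to `(·, ·)_G` (so `V⋆ = Vᵀ` in the Euclidean case `G = 1`). -/
def rbApprox {n m : ℕ} (G L : Matrix (Fin n) (Fin n) ℝ) (b : Fin n → ℝ)
    (V : Matrix (Fin n) (Fin m) ℝ) (t : ℝ) : Fin n → ℝ :=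
  V *ᵥ ((t • (1 : Matrix (Fin m) (Fin m) ℝ) + (Vᵀ * G) * L * V)⁻¹ *ᵥ ((Vᵀ * G) *ᵥ b))

open Classical in
/-- `Θ(z) = ∏_{t_j ≠ ∞} (z - t_j) / (z + t_j)`. -/
def Theta {k : ℕ} (τ : Fin (k + 1) → ℝ≥0∞) (z : ℝ) : ℝ :=
  ∏ j with τ j ≠ ∞, (z - (τ j).toReal) / (z + (τ j).toReal)

/-- The maximum norm of `f` on the set `S`. -/
def supNormOn (S : Set ℝ) (f : ℝ → ℝ) : ℝ :=
  sSup ((fun z => |f z|) '' S)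

end ReducedBasis

end

/-! The function `(1 - Θ(t) Θ(z)) / (t + z)` of `z` has no pole at `-t`, since `Θ(-t) = 1 / Θ(t)`,
so it is a combination of the fractions `1 / (z + sⱼ)` over the finite nodes
(`exists_partialFraction`). Hence `r(z) = 1 / (t + z) - ∑ aⱼ / (z + sⱼ)` equals `Θ(t) Θ(z) / (t +
z)`, which on `Σ` is at most `B = ‖Θ‖ / (t + λ_l)` because `|Θ(t)| ≤ 1`. Galerkin approximation is
exact at the nodes (`rbApprox_eq_resolventSolution`), so subtracting the same combination of
snapshots from both solutions writes the error as `V r(V⋆LV) V⋆b - r(L) b`. The eigenvalues of `L`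
and of its compression lie in `Σ`, so each term is at most `B ‖b‖` (`ipNorm_resolvent_sub_sum_le`);
the triangle inequality gives the factor 2. -/

open Finset in
/-- With `Θ(z) = ∏ (z - sⱼ) / (z + sⱼ)`, the rational function `(1 - Θ(t) Θ(z)) / (t + z)` of `z`
is a linear combination of the simple fractions `1 / (z + sⱼ)`. -/
theorem exists_partialFraction {ι : Type*} (S : Finset ι) (s : ι → ℝ) (hs : ∀ j ∈ S, 0 ≤ s j)
    (hinj : Set.InjOn s S) {t : ℝ} (ht : 0 ≤ t) :
    ∃ a : ι → ℝ, ∀ z : ℝ, 0 < z →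
      1 / (t + z) - ∑ j ∈ S, a j / (z + s j) =
        (∏ j ∈ S, (t - s j) / (t + s j)) * (∏ j ∈ S, (z - s j) / (z + s j)) / (t + z) := by
  classical
  induction S using Finset.induction_on with
  | empty => exact ⟨0, fun z _ => by simp⟩
  | insert i S hi ih =>
    obtain ⟨a, ha⟩ := ih (fun j hj => hs j (mem_insert_of_mem hj))
      (hinj.mono (by simp))
    have hi0 : 0 ≤ s i := hs i (mem_insert_self i S)
    have hne : ∀ j ∈ S, s j - s i ≠ 0 := by
      intro j hj h
      have := hinj (mem_insert_of_mem hj) (mem_insert_self i S) (sub_eq_zero.1 h)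
      exact hi (this ▸ hj)
    -- The one-node case. If `t = s i = 0`, the convention `0 / 0 = 0` makes the factor at `t`
    -- vanish, and `c = 1`.
    obtain ⟨c, hc⟩ : ∃ c : ℝ, ∀ z : ℝ, 0 < z →
        (1 - (t - s i) / (t + s i) * ((z - s i) / (z + s i))) / (t + z) = c / (z + s i) := by
      by_cases h0 : t + s i = 0
      · have h1 : s i = 0 := by linarith
        have h2 : t = 0 := by linarith
        exact ⟨1, fun z hz => by simp [h1, h2]⟩
      · refine ⟨2 * s i / (t + s i), fun z hz => ?_⟩
        have h1 : z + s i ≠ 0 := by positivity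
        have h2 : t + z ≠ 0 := by positivity
        field_simp
        ring
    set q := (t - s i) / (t + s i) with hq
    -- Multiplying the old sum by the new factor turns each `1 / (z + s j)` into `(z - s i) / ((z +
    -- s i) (z + s j))`; the coefficients are its residues at `-s i` and `-s j`.
    refine ⟨fun j => if j = i then c + ∑ l ∈ S, q * a l * (-2 * s i / (s l - s i))
      else q * a j * ((s j + s i) / (s j - s i)), fun z hz => ?_⟩
    rw [sum_insert hi, prod_insert hi, prod_insert hi]
    have hsum : ∑ j ∈ S, (if j = i then c + ∑ l ∈ S, q * a l * (-2 * s i / (s l - s i))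
        else q * a j * ((s j + s i) / (s j - s i))) / (z + s j) =
        ∑ j ∈ S, q * a j * ((s j + s i) / (s j - s i)) / (z + s j) :=
      sum_congr rfl fun j hj => by rw [if_neg (ne_of_mem_of_not_mem hj hi)]
    have hpf : ∑ j ∈ S, q * a j * (-2 * s i / (s j - s i)) / (z + s i) +
        ∑ j ∈ S, q * a j * ((s j + s i) / (s j - s i)) / (z + s j) =
        q * ((z - s i) / (z + s i)) * ∑ j ∈ S, a j / (z + s j) := by
      rw [← sum_add_distrib, mul_sum]
      refine sum_congr rfl fun j hj => ?_
      have h1 : z + s i ≠ 0 := by positivity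
      have h2 : z + s j ≠ 0 := by have := hs j (mem_insert_of_mem hj); positivity
      have h3 := hne j hj
      field_simp
      ring
    simp only [↓reduceIte]
    rw [hsum, add_div, sum_div, add_assoc, hpf, ← hc z hz, ← hq]
    have h2 : t + z ≠ 0 := by positivity
    have := ha z hz
    rw [sub_eq_iff_eq_add, ← sub_eq_iff_eq_add'] at this
    rw [← this]
    field_simp
    ring

/-! ### The inner product `(·, ·)_G` and its spectral theorem. -/

namespace ReducedBasis

open scoped Matrix ENNReal

theorem ip_comm {n : ℕ} {G : Matrix (Fin n) (Fin n) ℝ} (hG : G.PosDef) (x y : Fin n → ℝ) :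
    ip G x y = ip G y x := by
  have hGt : Gᵀ = G := by
    rw [← Matrix.conjTranspose_eq_transpose_of_trivial]
    exact hG.isHermitian.eq
  unfold ip
  rw [Matrix.dotProduct_mulVec, ← Matrix.mulVec_transpose, hGt, dotProduct_comm]

theorem ip_self_nonneg {n : ℕ} {G : Matrix (Fin n) (Fin n) ℝ} (hG : G.PosDef) (x : Fin n → ℝ) :
    0 ≤ ip G x x := by
  simpa [ip] using hG.posSemidef.dotProduct_mulVec_nonneg x

theorem ip_self_pos {n : ℕ} {G : Matrix (Fin n) (Fin n) ℝ} (hG : G.PosDef) {x : Fin n → ℝ}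
    (hx : x ≠ 0) : 0 < ip G x x := by
  simpa [ip] using hG.dotProduct_mulVec_pos hx

open scoped MatrixOrder in
/-- `ℝⁿ` with the inner product `(·, ·)_G` is isometric to Euclidean space. -/
theorem exists_linearEquiv_euclideanSpace {n : ℕ} {G : Matrix (Fin n) (Fin n) ℝ}
    (hG : G.PosDef) :
    ∃ φ : (Fin n → ℝ) ≃ₗ[ℝ] EuclideanSpace ℝ (Fin n), ∀ x y, inner ℝ (φ x) (φ y) = ip G x y := by
  -- With `G = Bᵀ B`, the map `x ↦ B x` is the isometry.
  obtain ⟨B, hB⟩ := CStarAlgebra.nonneg_iff_eq_star_mul_self.1 hG.posSemidef.nonneg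
  rw [Matrix.star_eq_conjTranspose, Matrix.conjTranspose_eq_transpose_of_trivial] at hB
  let f : (Fin n → ℝ) →ₗ[ℝ] EuclideanSpace ℝ (Fin n) :=
    (WithLp.linearEquiv 2 ℝ (Fin n → ℝ)).symm.toLinearMap ∘ₗ Matrix.toLin' B
  have hf : ∀ x y, inner ℝ (f x) (f y) = ip G x y := fun x y => by
    have h1 : inner ℝ (f x) (f y) = (B *ᵥ y) ⬝ᵥ (B *ᵥ x) := rfl
    rw [h1, ip, hB, ← Matrix.mulVec_mulVec, Matrix.dotProduct_mulVec x, Matrix.vecMul_transpose,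
      dotProduct_comm]
  have hinj : Function.Injective f := by
    rw [← LinearMap.ker_eq_bot, LinearMap.ker_eq_bot']
    intro x hx
    by_contra hx0
    have := ip_self_pos hG hx0
    rw [← hf, hx, inner_zero_left] at this
    exact this.false
  exact ⟨f.linearEquivOfInjective hinj (by simp), hf⟩

/-- A matrix that is self-adjoint for `(·, ·)_G` has an eigenbasis that is orthonormal for
`(·, ·)_G`; orthonormality is recorded as Parseval's identity. -/
theorem exists_eigenbasis {n : ℕ} {G A : Matrix (Fin n) (Fin n) ℝ} (hG : G.PosDef)
    (hA : SelfAdjointWrt G A) :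
    ∃ (u : Fin n → Fin n → ℝ) (μ : Fin n → ℝ),
      (∀ i, u i ≠ 0) ∧ (∀ i, A *ᵥ u i = μ i • u i) ∧
      ∀ x y, ip G x y = ∑ i, ip G (u i) x * ip G (u i) y := by
  obtain ⟨φ, hφ⟩ := exists_linearEquiv_euclideanSpace hG
  have hT : (φ.conj (Matrix.toLin' A)).IsSymmetric := fun x y => by
    obtain ⟨x, rfl⟩ := φ.surjective x
    obtain ⟨y, rfl⟩ := φ.surjective y
    simpa [LinearEquiv.conj_apply, hφ] using hA x y
  have hfin : Module.finrank ℝ (EuclideanSpace ℝ (Fin n)) = n := by simp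
  set e := hT.eigenvectorBasis hfin with he
  have hip : ∀ i x, ip G (φ.symm (e i)) x = inner ℝ (e i) (φ x) := fun i x => by
    rw [← hφ, LinearEquiv.apply_symm_apply]
  refine ⟨fun i => φ.symm (e i), hT.eigenvalues hfin, fun i => ?_, fun i => ?_, fun x y => ?_⟩
  · exact φ.symm.map_ne_zero_iff.2 (hT.hasEigenvector_eigenvectorBasis hfin i).2
  · apply φ.injective
    have := hT.apply_eigenvectorBasis hfin i
    rw [← he, LinearEquiv.conj_apply_apply, Matrix.toLin'_apply] at this
    simpa using this
  · rw [← hφ, ← e.sum_inner_mul_inner]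
    refine Finset.sum_congr rfl fun i _ => ?_
    rw [hip, hip, real_inner_comm]

theorem ipNorm_sub_le {n : ℕ} {G : Matrix (Fin n) (Fin n) ℝ} (hG : G.PosDef) (x y : Fin n → ℝ) :
    ipNorm G (x - y) ≤ ipNorm G x + ipNorm G y := by
  obtain ⟨φ, hφ⟩ := exists_linearEquiv_euclideanSpace hG
  have hnorm : ∀ x, ipNorm G x = ‖φ x‖ := fun x => by
    rw [norm_eq_sqrt_real_inner, hφ, ipNorm]
  simpa only [hnorm, map_sub] using norm_sub_le (φ x) (φ y)

/-! ### Resolvents and eigenvalue bounds. -/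

/-- `tI + A` is invertible if no eigenvalue of `A` equals `-t`. -/
theorem shift_mulVec_resolventSolution {n : ℕ} {A : Matrix (Fin n) (Fin n) ℝ} {t : ℝ}
    (h : ∀ v, v ≠ 0 → A *ᵥ v ≠ (-t) • v) (x : Fin n → ℝ) :
    t • resolventSolution A x t + A *ᵥ resolventSolution A x t = x := by
  have hinj : Function.Injective (t • (1 : Matrix (Fin n) (Fin n) ℝ) + A).mulVec := by
    rw [← Matrix.coe_mulVecLin, ← LinearMap.ker_eq_bot, LinearMap.ker_eq_bot']
    intro v hv
    by_contra hv0
    refine h v hv0 ?_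
    rw [Matrix.mulVecLin_apply, Matrix.add_mulVec, Matrix.smul_mulVec, Matrix.one_mulVec] at hv
    rw [neg_smul]
    exact eq_neg_of_add_eq_zero_right hv
  have hu := (Matrix.isUnit_iff_isUnit_det _).1 (Matrix.mulVec_injective_iff_isUnit.1 hinj)
  have : (t • (1 : Matrix (Fin n) (Fin n) ℝ) + A) *ᵥ resolventSolution A x t = x := by
    rw [resolventSolution, Matrix.mulVec_mulVec, Matrix.mul_nonsing_inv _ hu, Matrix.one_mulVec]
  rwa [Matrix.add_mulVec, Matrix.smul_mulVec, Matrix.one_mulVec] at this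

theorem eq_resolventSolution {n : ℕ} {A : Matrix (Fin n) (Fin n) ℝ} {t : ℝ}
    (h : ∀ v, v ≠ 0 → A *ᵥ v ≠ (-t) • v) {x y : Fin n → ℝ} (hy : t • y + A *ᵥ y = x) :
    y = resolventSolution A x t := by
  have h1 := shift_mulVec_resolventSolution h x
  by_contra hne
  refine h _ (sub_ne_zero.2 hne) ?_
  rw [Matrix.mulVec_sub, neg_smul, smul_sub, eq_neg_iff_add_eq_zero]
  have h2 := hy.trans h1.symm
  rw [← sub_eq_zero] at h2
  rw [← h2]
  abel

/-- The eigenvalues of `A` lie in `S`. -/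
def EigenvaluesIn {n : ℕ} (A : Matrix (Fin n) (Fin n) ℝ) (S : Set ℝ) : Prop :=
  ∀ (μ : ℝ) (v : Fin n → ℝ), v ≠ 0 → A *ᵥ v = μ • v → μ ∈ S

theorem EigenvaluesIn.ne_neg {n : ℕ} {A : Matrix (Fin n) (Fin n) ℝ} {l u t : ℝ}
    (h : EigenvaluesIn A (Set.Icc l u)) (hl : 0 < l) (ht : 0 ≤ t) :
    ∀ v, v ≠ 0 → A *ᵥ v ≠ (-t) • v := fun v hv hAv => by
  have := (h _ v hv hAv).1
  linarith

theorem ip_add_right {n : ℕ} (G : Matrix (Fin n) (Fin n) ℝ) (x y z : Fin n → ℝ) :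
    ip G x (y + z) = ip G x y + ip G x z := by
  simp [ip, Matrix.mulVec_add, dotProduct_add]

theorem ip_sub_right {n : ℕ} (G : Matrix (Fin n) (Fin n) ℝ) (x y z : Fin n → ℝ) :
    ip G x (y - z) = ip G x y - ip G x z := by
  simp [ip, Matrix.mulVec_sub, dotProduct_sub]

theorem ip_smul_right {n : ℕ} (G : Matrix (Fin n) (Fin n) ℝ) (c : ℝ) (x y : Fin n → ℝ) :
    ip G x (c • y) = c * ip G x y := by
  simp [ip, Matrix.mulVec_smul, dotProduct_smul]

theorem ip_smul_left {n : ℕ} (G : Matrix (Fin n) (Fin n) ℝ) (c : ℝ) (x y : Fin n → ℝ) :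
    ip G (c • x) y = c * ip G x y := by
  simp [ip, smul_dotProduct]

theorem ip_sum_right {n : ℕ} {ι : Type*} (G : Matrix (Fin n) (Fin n) ℝ) (x : Fin n → ℝ)
    (S : Finset ι) (y : ι → Fin n → ℝ) :
    ip G x (∑ j ∈ S, y j) = ∑ j ∈ S, ip G x (y j) := by
  simp [ip, Matrix.mulVec_sum, dotProduct_sum]

/-- The Rayleigh quotients of a self-adjoint matrix are enclosed by its eigenvalues. -/
theorem rayleigh_mem {n : ℕ} {G A : Matrix (Fin n) (Fin n) ℝ} (hG : G.PosDef)
    (hA : SelfAdjointWrt G A) {l u : ℝ} (hS : EigenvaluesIn A (Set.Icc l u)) (x : Fin n → ℝ) :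
    l * ip G x x ≤ ip G x (A *ᵥ x) ∧ ip G x (A *ᵥ x) ≤ u * ip G x x := by
  obtain ⟨e, μ, he0, hev, hP⟩ := exists_eigenbasis hG hA
  have hcoord : ∀ i, ip G (e i) (A *ᵥ x) = μ i * ip G (e i) x := fun i => by
    rw [← hA, hev, ip_smul_left]
  rw [hP x x, hP x (A *ᵥ x), Finset.mul_sum, Finset.mul_sum]
  constructor <;> refine Finset.sum_le_sum fun i _ => ?_ <;> rw [hcoord]
  · nlinarith [(hS _ _ (he0 i) (hev i)).1, mul_self_nonneg (ip G (e i) x)]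
  · nlinarith [(hS _ _ (he0 i) (hev i)).2, mul_self_nonneg (ip G (e i) x)]

/-- A bound on the scalar error `1 / (t + z) - ∑ aⱼ / (z + sⱼ)` over an interval containing the
spectrum carries over to the resolvents of a self-adjoint matrix. -/
theorem ipNorm_resolvent_sub_sum_le {n : ℕ} {ι : Type*} {G A : Matrix (Fin n) (Fin n) ℝ}
    (hG : G.PosDef) (hA : SelfAdjointWrt G A) {l u : ℝ} (hl : 0 < l)
    (hS : EigenvaluesIn A (Set.Icc l u)) {t : ℝ} (ht : 0 ≤ t) (J : Finset ι) (s a : ι → ℝ)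
    (hs : ∀ j ∈ J, 0 ≤ s j) {B : ℝ} (hB0 : 0 ≤ B)
    (hB : ∀ z ∈ Set.Icc l u, |1 / (t + z) - ∑ j ∈ J, a j / (z + s j)| ≤ B) (x : Fin n → ℝ) :
    ipNorm G (resolventSolution A x t - ∑ j ∈ J, a j • resolventSolution A x (s j)) ≤
      B * ipNorm G x := by
  obtain ⟨e, μ, he0, hev, hP⟩ := exists_eigenbasis hG hA
  have hmem : ∀ i, μ i ∈ Set.Icc l u := fun i => hS _ _ (he0 i) (hev i)
  have hcoord : ∀ i (r : ℝ), 0 ≤ r →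
      ip G (e i) (resolventSolution A x r) = ip G (e i) x / (r + μ i) := by
    intro i r hr
    have h0 : r + μ i ≠ 0 := by have := (hmem i).1; exact (by linarith : 0 < r + μ i).ne'
    have h1 := congrArg (ip G (e i)) (shift_mulVec_resolventSolution (hS.ne_neg hl hr) x)
    rw [ip_add_right, ip_smul_right, ← hA, hev, ip_smul_left] at h1
    rw [eq_div_iff h0, ← h1]
    ring
  have hdiff : ∀ i, ip G (e i)
      (resolventSolution A x t - ∑ j ∈ J, a j • resolventSolution A x (s j)) =
      (1 / (t + μ i) - ∑ j ∈ J, a j / (μ i + s j)) * ip G (e i) x := by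
    intro i
    rw [ip_sub_right, ip_sum_right, hcoord i t ht, sub_mul, Finset.sum_mul]
    congr 1
    · ring
    · refine Finset.sum_congr rfl fun j hj => ?_
      rw [ip_smul_right, hcoord i _ (hs j hj), add_comm (μ i)]
      ring
  unfold ipNorm
  rw [← Real.sqrt_sq hB0, ← Real.sqrt_mul (sq_nonneg B)]
  refine Real.sqrt_le_sqrt ?_
  rw [hP, hP x x, Finset.mul_sum]
  refine Finset.sum_le_sum fun i _ => ?_
  rw [hdiff, ← sq, mul_pow, ← sq (ip G (e i) x)]
  refine mul_le_mul_of_nonneg_right ?_ (sq_nonneg _)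
  exact sq_le_sq.2 ((hB _ (hmem i)).trans (le_abs_self B))

theorem eigenvaluesIn_of_spectralInterval_subset {n : ℕ} {A : Matrix (Fin n) (Fin n) ℝ}
    {S : Set ℝ} (h : spectralInterval A ⊆ S) : EigenvaluesIn A S := by
  intro μ v hv hAv
  have hmem : μ ∈ spectrum ℝ A := by
    rw [← Matrix.spectrum_toLin', ← Module.End.hasEigenvalue_iff_mem_spectrum]
    exact Module.End.hasEigenvalue_of_hasEigenvector
      ⟨Module.End.mem_eigenspace_iff.2 (by simpa using hAv), hv⟩
  have hfin : (spectrum ℝ A).Finite := A.finite_spectrum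
  -- Finiteness of the spectrum makes `sInf` and `sSup` genuine bounds.
  exact h ⟨csInf_le hfin.bddBelow hmem, le_csSup hfin.bddAbove hmem⟩

/-! ### Compression to the reduced space. -/

section Galerkin

variable {n m : ℕ} {G L : Matrix (Fin n) (Fin n) ℝ} {V : Matrix (Fin n) (Fin m) ℝ}

/-- The defining property of the adjoint `V⋆ = Vᵀ G`. -/
theorem ip_one_adjoint (x : Fin m → ℝ) (y : Fin n → ℝ) :
    ip 1 x ((Vᵀ * G) *ᵥ y) = ip G (V *ᵥ x) y := by
  unfold ip
  rw [Matrix.one_mulVec, ← Matrix.mulVec_mulVec, Matrix.dotProduct_mulVec, Matrix.vecMul_transpose]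

theorem ip_mulVec_mulVec (hV : Vᵀ * G * V = 1) (x y : Fin m → ℝ) :
    ip G (V *ᵥ x) (V *ᵥ y) = ip 1 x y := by
  rw [← ip_one_adjoint, Matrix.mulVec_mulVec, hV, Matrix.one_mulVec]

theorem ipNorm_mulVec (hV : Vᵀ * G * V = 1) (x : Fin m → ℝ) :
    ipNorm G (V *ᵥ x) = ipNorm 1 x := by
  rw [ipNorm, ipNorm, ip_mulVec_mulVec hV]

/-- Pythagoras: `0 ≤ ‖y - V V⋆ y‖² = ‖y‖² - ‖V⋆ y‖²`. -/
theorem ipNorm_adjoint_le (hG : G.PosDef) (hV : Vᵀ * G * V = 1) (y : Fin n → ℝ) :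
    ipNorm 1 ((Vᵀ * G) *ᵥ y) ≤ ipNorm G y := by
  refine Real.sqrt_le_sqrt ?_
  set c := (Vᵀ * G) *ᵥ y with hc
  have h1 : ip G (V *ᵥ c) y = ip 1 c c := by rw [← ip_one_adjoint]
  have h2 := ip_self_nonneg hG (y - V *ᵥ c)
  rw [ip_sub_right, ip_comm hG _ y, ip_comm hG _ (V *ᵥ c), ip_sub_right, ip_sub_right,
    ip_mulVec_mulVec hV, ip_comm hG y (V *ᵥ c), h1] at h2
  linarith

theorem ip_one_compression (x y : Fin m → ℝ) :
    ip 1 x ((Vᵀ * G * L * V) *ᵥ y) = ip G (V *ᵥ x) (L *ᵥ V *ᵥ y) := by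
  rw [← ip_one_adjoint, Matrix.mulVec_mulVec, Matrix.mulVec_mulVec]

theorem selfAdjointWrt_compression (hG : G.PosDef) (hL : SelfAdjointWrt G L) :
    SelfAdjointWrt 1 (Vᵀ * G * L * V) := fun x y => by
  rw [ip_comm Matrix.PosDef.one, ip_one_compression, ip_one_compression, ← hL, ip_comm hG]

/-- The Rayleigh quotient of the compression at `v` is that of `L` at `V v`. -/
theorem EigenvaluesIn.compression (hG : G.PosDef) (hL : SelfAdjointWrt G L)
    (hV : Vᵀ * G * V = 1) {l u : ℝ} (hS : EigenvaluesIn L (Set.Icc l u)) :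
    EigenvaluesIn (Vᵀ * G * L * V) (Set.Icc l u) := by
  intro μ v hv hμ
  have hpos := ip_self_pos Matrix.PosDef.one hv
  have h := rayleigh_mem hG hL hS (V *ᵥ v)
  rw [← ip_one_compression, hμ, ip_smul_right, ip_mulVec_mulVec hV] at h
  exact ⟨le_of_mul_le_mul_right h.1 hpos, le_of_mul_le_mul_right h.2 hpos⟩

/-- The Galerkin approximation reproduces every `w(s)` that lies in the reduced space. -/
theorem rbApprox_eq_resolventSolution (hG : G.PosDef) (hL : SelfAdjointWrt G L)
    (hV : Vᵀ * G * V = 1) {l u : ℝ} (hl : 0 < l) (hS : EigenvaluesIn L (Set.Icc l u))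
    {b : Fin n → ℝ} {s : ℝ} (hs : 0 ≤ s)
    (hmem : resolventSolution L b s ∈ Submodule.span ℝ (Set.range fun i => Vᵀ i)) :
    rbApprox G L b V s = resolventSolution L b s := by
  obtain ⟨y, hy⟩ : ∃ y, V *ᵥ y = resolventSolution L b s := by
    change _ ∈ Submodule.span ℝ (Set.range V.col) at hmem
    rw [← Matrix.range_mulVecLin] at hmem
    exact hmem
  -- Apply `V⋆` to `(sI + L) V y = b` and use `V⋆ V = I`; uniqueness for the reduced system then
  -- identifies `y`.
  have h1 : s • y + (Vᵀ * G * L * V) *ᵥ y = (Vᵀ * G) *ᵥ b := by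
    rw [← shift_mulVec_resolventSolution (hS.ne_neg hl hs) b, ← hy, Matrix.mulVec_add,
      Matrix.mulVec_smul, Matrix.mulVec_mulVec, hV, Matrix.one_mulVec, Matrix.mulVec_mulVec,
      Matrix.mulVec_mulVec]
  rw [← hy, eq_resolventSolution ((hS.compression hG hL hV).ne_neg hl hs) h1]
  rfl

end Galerkin

/-! ### Bounds on `Θ` and the error estimate. -/

theorem abs_Theta_le_one {k : ℕ} (τ : Fin (k + 1) → ℝ≥0∞) {z : ℝ} (hz : 0 ≤ z) :
    |Theta τ z| ≤ 1 := by
  rw [Theta, Finset.abs_prod]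
  refine Finset.prod_le_one (fun _ _ => abs_nonneg _) fun j _ => ?_
  have hj : 0 ≤ (τ j).toReal := ENNReal.toReal_nonneg
  rw [abs_div]
  refine div_le_one_of_le₀ ?_ (abs_nonneg _)
  rw [abs_of_nonneg (add_nonneg hz hj), abs_le]
  constructor <;> linarith

theorem abs_Theta_le_supNormOn {k : ℕ} (τ : Fin (k + 1) → ℝ≥0∞) {l u z : ℝ} (hl : 0 < l)
    (hz : z ∈ Set.Icc l u) : |Theta τ z| ≤ supNormOn (Set.Icc l u) (Theta τ) := by
  -- The bound 1 is needed because a real `sSup` of an unbounded set defaults to 0.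
  refine le_csSup ⟨1, ?_⟩ ⟨z, hz, rfl⟩
  rintro _ ⟨y, hy, rfl⟩
  exact abs_Theta_le_one τ (hl.le.trans hy.1)

theorem supNormOn_nonneg (S : Set ℝ) (f : ℝ → ℝ) : 0 ≤ supNormOn S f := by
  refine Real.sSup_nonneg ?_
  rintro _ ⟨z, _, rfl⟩
  exact abs_nonneg _

/-- Reduced basis error bound for an operator that is self-adjoint for `(·, ·)_G`. -/
theorem ipNorm_rbApprox_sub_resolventSolution_le {n k m : ℕ} {G L : Matrix (Fin n) (Fin n) ℝ}
    (hG : G.PosDef) (hL : SelfAdjointWrt G L) (b : Fin n → ℝ) {τ : Fin (k + 1) → ℝ≥0∞}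
    (hτ : Function.Injective τ) {V : Matrix (Fin n) (Fin m) ℝ}
    (hV : IsOrthonormalBasisOf G V (reducedSpace L b τ)) {t : ℝ} (ht : 0 ≤ t) {l u : ℝ}
    (hl : 0 < l) (hS : EigenvaluesIn L (Set.Icc l u)) :
    ipNorm G (rbApprox G L b V t - resolventSolution L b t) ≤
      2 / (t + l) * supNormOn (Set.Icc l u) (Theta τ) * ipNorm G b := by
  classical
  obtain ⟨hVorth, hVspan⟩ := hV
  set J : Finset (Fin (k + 1)) := {j | τ j ≠ ∞} with hJ
  have hJmem : ∀ j ∈ J, τ j ≠ ∞ := fun j hj => by simpa [hJ] using hj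
  have hs : ∀ j ∈ J, 0 ≤ (τ j).toReal := fun j _ => ENNReal.toReal_nonneg
  obtain ⟨a, ha⟩ := exists_partialFraction J (fun j => (τ j).toReal) hs
    (fun i hi j hj hij => hτ
      ((ENNReal.toReal_eq_toReal_iff' (hJmem i hi) (hJmem j hj)).1 hij)) ht
  have hTheta : ∀ z, ∏ j ∈ J, (z - (τ j).toReal) / (z + (τ j).toReal) = Theta τ z := fun z => by
    rw [hJ, Theta]
  have hN := supNormOn_nonneg (Set.Icc l u) (Theta τ)
  set B := supNormOn (Set.Icc l u) (Theta τ) / (t + l) with hBdef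
  have hB0 : 0 ≤ B := by positivity
  have hB : ∀ z ∈ Set.Icc l u, |1 / (t + z) - ∑ j ∈ J, a j / (z + (τ j).toReal)| ≤ B := by
    intro z hz
    have hz0 : 0 < z := hl.trans_le hz.1
    rw [ha z hz0, hTheta, hTheta, abs_div, abs_mul, abs_of_pos (by positivity : 0 < t + z)]
    refine div_le_div₀ hN ?_ (by positivity) (by linarith [hz.1])
    exact (mul_le_of_le_one_left (abs_nonneg _) (abs_Theta_le_one τ ht)).trans
      (abs_Theta_le_supNormOn τ hl hz)
  have hexact : ∀ j ∈ J, rbApprox G L b V (τ j).toReal = resolventSolution L b (τ j).toReal := by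
    intro j hj
    refine rbApprox_eq_resolventSolution hG hL hVorth hl hS (hs j hj) ?_
    rw [hVspan]
    exact Submodule.subset_span ⟨j, by simp [snapshotSolution, hJmem j hj]⟩
  set A := Vᵀ * G * L * V with hA
  set c := (Vᵀ * G) *ᵥ b with hc
  have hrb : ∀ r, rbApprox G L b V r = V *ᵥ resolventSolution A c r := fun r => rfl
  -- By `hexact` the two sums cancel after `V` is applied to the reduced one.
  have hsplit : rbApprox G L b V t - resolventSolution L b t =
      V *ᵥ (resolventSolution A c t - ∑ j ∈ J, a j • resolventSolution A c (τ j).toReal) -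
      (resolventSolution L b t - ∑ j ∈ J, a j • resolventSolution L b (τ j).toReal) := by
    rw [Matrix.mulVec_sub, Matrix.mulVec_sum, hrb]
    have : ∑ j ∈ J, V *ᵥ (a j • resolventSolution A c (τ j).toReal) =
        ∑ j ∈ J, a j • resolventSolution L b (τ j).toReal :=
      Finset.sum_congr rfl fun j hj => by rw [Matrix.mulVec_smul, ← hrb, hexact j hj]
    rw [this]
    abel
  have hred := ipNorm_resolvent_sub_sum_le Matrix.PosDef.one
    (selfAdjointWrt_compression (V := V) hG hL) hl (hS.compression hG hL hVorth) ht J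
    (fun j => (τ j).toReal) a hs hB0 hB c
  have hfull := ipNorm_resolvent_sub_sum_le hG hL hl hS ht J
    (fun j => (τ j).toReal) a hs hB0 hB b
  rw [hsplit]
  calc _ ≤ _ := ipNorm_sub_le hG _ _
    _ ≤ B * ipNorm 1 c + B * ipNorm G b := by
      rw [ipNorm_mulVec hVorth]
      exact add_le_add hred hfull
    _ ≤ B * ipNorm G b + B * ipNorm G b := by
      gcongr
      exact ipNorm_adjoint_le hG hVorth b
    _ = _ := by rw [hBdef]; ring

end ReducedBasis

theorem mainTheorem4 {n k m : ℕ}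
    (M K : Matrix (Fin n) (Fin n) ℝ) (hM : M.PosDef) (hK : K.PosDef)
    (G : Matrix (Fin n) (Fin n) ℝ) (hG : G.PosDef)
    (hL : ReducedBasis.SelfAdjointWrt G (ReducedBasis.diffusionMatrix M K))
    (b : Fin n → ℝ)
    (τ : Fin (k + 1) → ENNReal) (hτ : Function.Injective τ)
    (V : Matrix (Fin n) (Fin m) ℝ)
    (hV : ReducedBasis.IsOrthonormalBasisOf G V
      (ReducedBasis.reducedSpace (ReducedBasis.diffusionMatrix M K) b τ))
    (t : ℝ) (ht : 0 ≤ t)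
    (lamL lamU : ℝ) (hlam : 0 < lamL)
    (hSigma : ReducedBasis.spectralInterval (ReducedBasis.diffusionMatrix M K) ⊆
      Set.Icc lamL lamU) :
    ReducedBasis.ipNorm G
        (ReducedBasis.rbApprox G (ReducedBasis.diffusionMatrix M K) b V t -
          ReducedBasis.resolventSolution (ReducedBasis.diffusionMatrix M K) b t) ≤
      2 / (t + lamL) *
        ReducedBasis.supNormOn (Set.Icc lamL lamU) (ReducedBasis.Theta τ) *
        ReducedBasis.ipNorm G b := by
  exact ReducedBasis.ipNorm_rbApprox_sub_resolventSolution_le hG hL b hτ hV ht hlam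
    (ReducedBasis.eigenvaluesIn_of_spectralInterval_subset hSigma)
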